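/- All graphs are finite and simple. For a graph $F$, a hypergraph $\mathcal{B}$ is a Berge-$F$ if there are an injection $f:V(F)\to V(\mathcal{B})$ and a bijection $\phi:E(F)\to E(\mathcal{B})$ such that $\{f(u),f(v)\}\subseteq\phi(uv)$ for every $uv\in E(F)$. A $k$-uniform hypergraph $\mathcal{H}$ is Berge-$F$-saturated if no subhypergraph of $\mathcal{H}$ is a Berge-$F$, but for every $k$-subset $e$ of $V(\mathcal{H})$ with $e\notin E(\mathcal{H})$ the hypergraph $\mathcal{H}+e$ has a subhypergraph that is a Berge-$F$. Let $\mathrm{sat}_k(n,\text{Berge-}F)$ be the least number of edges in a $k$-uniform Berge-$F$-saturated hypergraph on $n$ vertices. **Theorem 1.4.** Let $F$ be a graph with minimum degree $\delta(F)$ and independence number $\alpha(F)$, and let $k\ge 3$. If $$\delta(F)>\frac{|V(F)|-\alpha(F)}{2},$$ then $\mathrm{sat}_k(n,\text{Berge-}F)$ is well defined for every $n$ (a $k$-uniform Berge-$F$-saturated hypergraph on $n$ vertices exists), and $$\mathrm{sat}_k(n,\text{Berge-}F)=O(n)\qquad\text{as } n\to\infty,$$ where $k$ and $F$ are fixed (the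 implied constant may depend on $k$ and $F$). -/

import Mathlib

open Filter Asymptotics

/-- A hypergraph on the vertex set `α` is given by its finite set `B` of edges, each edge being a
finite set of vertices. It is a Berge-`F` if the vertices of `F` can be embedded in `α` so that
there is a bijection `φ` from the edges of `F` onto the edges of `B` with `e ⊆ φ e` for all `e`. -/
def IsBerge {V α : Type*} (F : SimpleGraph V) (B : Finset (Finset α)) : Prop :=
  ∃ f : V ↪ α, ∃ φ : F.edgeSet ≃ B, ∀ e : F.edgeSet, ∀ v ∈ (e : Sym2 V), f v ∈ (φ e : Finset α)

/-- `H` contains a Berge-`F`: some subhypergraph of `H` is a Berge-`F`. -/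
def ContainsBerge {V α : Type*} (F : SimpleGraph V) (H : Finset (Finset α)) : Prop :=
  ∃ B ⊆ H, IsBerge F B

/-- `H` is a `k`-uniform Berge-`F`-saturated hypergraph on the vertex set `α`: all edges have
`k` vertices, `H` contains no Berge-`F`, and adding any missing `k`-edge creates one. -/
def IsBergeSaturated {V α : Type*} [DecidableEq α] (k : ℕ) (F : SimpleGraph V)
    (H : Finset (Finset α)) : Prop :=
  (∀ e ∈ H, e.card = k) ∧ ¬ ContainsBerge F H ∧
    ∀ e : Finset α, e.card = k → e ∉ H → ContainsBerge F (insert e H)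

/-- The saturation number `sat_k(n, Berge-F)`: the least number of edges in a `k`-uniform
Berge-`F`-saturated hypergraph on `n` vertices. -/
noncomputable def bergeSat {V : Type*} (k n : ℕ) (F : SimpleGraph V) : ℕ :=
  sInf {m : ℕ | ∃ H : Finset (Finset (Fin n)), IsBergeSaturated k F H ∧ H.card = m}

/-! Let `τ = |V| - α(F)` be the vertex cover number of `F`; the hypothesis on the minimum degree says
`τ < 2 δ(F)`. Some hypergraph with linearly many edges is Berge-`F`-free and forces every
Berge-`F`-free extension to have linearly many edges as well; a maximal extension is then saturated.

This hypergraph, `skeleton`, has a core `S` of `τ - 1` vertices. Almost all other vertices are split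
into blocks of `k - 1` vertices, and every core vertex together with every block is an edge. In
addition, every two core vertices lie in an edge of their own, filled up with padding vertices that
occur in no other edge.

*The skeleton is Berge-`F`-free* (`not_containsBerge_of_locally_sparse`). If two vertices of a copy
outside `S` are adjacent in `F`, their common hyperedge puts them into the same block (or the same
padding set). Together they are incident to at least `2 δ(F) - 1 ≥ τ` edges of `F`, but at most
`τ - 1` skeleton edges meet a given block, and only one meets a given padding set. So the vertices
of the copy outside `S` are independent in `F`; there are at least `|V| - (τ - 1) = α(F) + 1` of
them, which is too many.

*Block vertices have bounded degree in a Berge-`F`-free extension* (`degree_le_of_not_containsBerge`).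
If a block vertex `v` has huge degree, `α(F)` of its edges lead to vertices in distinct blocks, all
different from the block of `v` (`exists_transversal`). Such edges are not skeleton edges. Mapping a
maximum independent set of `F` to these vertices, one further vertex `t₀` of `F` to `v`, and the
remaining `τ - 1` vertices to `S` gives a Berge-`F` (`containsBerge_of_star`): the blocks being
distinct, all edges between core and star have their own block edges.

All but a bounded number of vertices lie in blocks, so an extension has `O(n)` edges. -/

open Finset

/-! ### Berge copies and saturation -/

theorem containsBerge_of_injective {V α : Type*} {F : SimpleGraph V} {H : Finset (Finset α)}
    (f : V → α) (hf : Function.Injective f) (ψ : F.edgeSet → Finset α)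
    (hψ : Function.Injective ψ) (hH : ∀ e, ψ e ∈ H)
    (hmem : ∀ e : F.edgeSet, ∀ v ∈ (e : Sym2 V), f v ∈ ψ e) : ContainsBerge F H := by
  classical
  have hfin : Finite F.edgeSet :=
    Finite.of_injective (fun e => (⟨ψ e, hH e⟩ : H)) fun a b h => hψ (congrArg Subtype.val h)
  have := Fintype.ofFinite F.edgeSet
  refine ⟨univ.image ψ, image_subset_iff.2 fun e _ => hH e, ⟨f, hf⟩,
    Equiv.ofBijective (fun e => ⟨ψ e, mem_image_of_mem _ (mem_univ _)⟩) ⟨?_, ?_⟩, hmem⟩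
  · intro a b h
    exact hψ (congrArg Subtype.val h)
  · rintro ⟨B, hB⟩
    obtain ⟨e, -, rfl⟩ := mem_image.1 hB
    exact ⟨e, rfl⟩

theorem exists_isBergeSaturated_superset {V α : Type*} [Fintype α] [DecidableEq α]
    {F : SimpleGraph V} {k : ℕ} {H₀ : Finset (Finset α)} (hk : ∀ e ∈ H₀, e.card = k)
    (hfree : ¬ ContainsBerge F H₀) : ∃ H, H₀ ⊆ H ∧ IsBergeSaturated k F H := by
  obtain ⟨H, hle, hmax⟩ := Set.Finite.exists_le_maximal
    (s := {H : Finset (Finset α) | (∀ e ∈ H, e.card = k) ∧ ¬ ContainsBerge F H})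
    (Set.toFinite _) (a := H₀) ⟨hk, hfree⟩
  refine ⟨H, hle, hmax.prop.1, hmax.prop.2, fun e he heH => ?_⟩
  by_contra hcon
  refine heH (hmax.le_of_ge (y := insert e H) ⟨?_, hcon⟩ (subset_insert e H) (mem_insert_self e H))
  intro a ha
  rcases mem_insert.1 ha with rfl | ha
  exacts [he, hmax.prop.1 a ha]

theorem not_containsBerge_empty {V α : Type*} {F : SimpleGraph V} {u v : V} (h : F.Adj u v) :
    ¬ ContainsBerge F (∅ : Finset (Finset α)) := by
  rintro ⟨B, hB, f, φ, -⟩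
  obtain rfl := subset_empty.1 hB
  exact notMem_empty _ (φ ⟨s(u, v), h⟩).2

/-- The vertices of a Berge-`F` lying outside `S` are independent in `F`: the images of two adjacent
ones would share a hyperedge, while together they need at least `2 * δ(F) - 1` distinct ones. -/
theorem not_containsBerge_of_locally_sparse {V α : Type*} [Fintype V] {F : SimpleGraph V}
    [DecidableRel F.Adj] [DecidableEq α] {H : Finset (Finset α)} {S : Finset α} {c : ℕ}
    (hS : S.card ≤ c) (hδ : c + 1 < 2 * F.minDegree) (hα : F.indepNum + c < Fintype.card V)
    (hH : ∀ e ∈ H, ∃ A : Finset (Finset α), A.card ≤ c ∧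
      ∀ x ∈ e, x ∉ S → ∀ g ∈ H, x ∈ g → g ∈ A) : ¬ ContainsBerge F H := by
  classical
  rintro ⟨B, hBH, f, φ, hφ⟩
  have hind : F.IsIndepSet (univ.filter fun u => f u ∉ S : Finset V) := by
    intro u hu v hv _ huv
    simp only [coe_filter, mem_univ, true_and, Set.mem_ofPred_eq] at hu hv
    obtain ⟨A, hA, hAH⟩ := hH _ (hBH (φ ⟨s(u, v), huv⟩).2)
    have hu' := hAH _ (hφ ⟨s(u, v), huv⟩ u (by simp)) hu
    have hv' := hAH _ (hφ ⟨s(u, v), huv⟩ v (by simp)) hv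
    -- All edges of `F` at `u` or `v` are sent to `A`.
    have hle : (F.incidenceFinset u ∪ F.incidenceFinset v).card ≤ A.card := by
      refine card_le_card_of_injOn
        (fun e => if he : e ∈ F.edgeSet then (φ ⟨e, he⟩ : Finset α) else ∅) ?_ ?_
      · intro e he
        simp only [coe_union, Set.mem_union, mem_coe, SimpleGraph.mem_incidenceFinset] at he
        rcases he with he | he
        · simpa [he.1] using hu' _ (hBH (φ ⟨e, he.1⟩).2) (hφ ⟨e, he.1⟩ u he.2)
        · simpa [he.1] using hv' _ (hBH (φ ⟨e, he.1⟩).2) (hφ ⟨e, he.1⟩ v he.2)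
      · intro a ha b hb hab
        have ha' : a ∈ F.edgeSet := by
          simp only [coe_union, Set.mem_union, mem_coe, SimpleGraph.mem_incidenceFinset] at ha
          exact ha.elim (·.1) (·.1)
        have hb' : b ∈ F.edgeSet := by
          simp only [coe_union, Set.mem_union, mem_coe, SimpleGraph.mem_incidenceFinset] at hb
          exact hb.elim (·.1) (·.1)
        simp only [ha', hb', dif_pos] at hab
        exact congrArg Subtype.val (φ.injective (Subtype.ext hab))
    have hinter : (F.incidenceFinset u ∩ F.incidenceFinset v).card ≤ 1 := by
      refine (card_le_card (t := {s(u, v)}) ?_).trans (card_singleton _).le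
      intro e he
      simp only [mem_inter, SimpleGraph.mem_incidenceFinset] at he
      exact mem_singleton.2 ((Sym2.mem_and_mem_iff huv.ne).1 ⟨he.1.2, he.2.2⟩)
    have := card_union_add_card_inter (F.incidenceFinset u) (F.incidenceFinset v)
    rw [F.card_incidenceFinset_eq_degree, F.card_incidenceFinset_eq_degree] at this
    have h1 := F.minDegree_le_degree u
    have h2 := F.minDegree_le_degree v
    omega
  have h1 := hind.card_le_indepNum
  have h2 : (univ.filter fun u => f u ∈ S).card ≤ S.card :=
    card_le_card_of_injOn f (fun u hu => by simpa using hu) f.injective.injOn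
  have h3 := card_filter_add_card_filter_not (s := (univ : Finset V)) (fun u => f u ∈ S)
  rw [card_univ] at h3
  omega

/-! ### Choosing a large star across distinct blocks -/

/-- If all vertices outside `X` are covered by the blocks `G j`, then a large enough family of edges
has `m` members that meet `m` distinct blocks outside `X`. -/
theorem exists_transversal {α β : Type*} [DecidableEq α] (G : β → Finset α) {d : ℕ}
    (hG : ∀ j, (G j).card ≤ d) (m : ℕ) (X : Finset α) (E : Finset (Finset α))
    (hX : ∀ x ∉ X, ∃ j, x ∈ G j) (hE : m + 2 ^ (X.card + m * d) < E.card) :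
    ∃ (h : Fin m → Finset α) (w : Fin m → α) (j : Fin m → β), Function.Injective h ∧
      Function.Injective j ∧ ∀ i, h i ∈ E ∧ w i ∈ h i ∧ w i ∈ G (j i) ∧ w i ∉ X := by
  induction m generalizing X E with
  | zero =>
    exact ⟨Fin.elim0, Fin.elim0, Fin.elim0, fun i => i.elim0, fun i => i.elim0, fun i => i.elim0⟩
  | succ m ih =>
    have hnot : ¬ E ⊆ X.powerset := by
      intro hsub
      have h1 := card_le_card hsub
      rw [card_powerset] at h1
      have : 2 ^ X.card ≤ 2 ^ (X.card + (m + 1) * d) := Nat.pow_le_pow_right (by norm_num) (by simp)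
      omega
    obtain ⟨h₀, hh₀, hh₀X⟩ := not_subset.1 hnot
    obtain ⟨x, hx, hxX⟩ := not_subset.1 (fun h => hh₀X (mem_powerset.2 h))
    obtain ⟨j₀, hj₀⟩ := hX x hxX
    have hcard : (X ∪ G j₀).card + m * d ≤ X.card + (m + 1) * d := by
      have := card_union_le X (G j₀)
      have := hG j₀
      rw [add_mul]
      omega
    -- Adding the used block to `X` keeps the later choices away from it.
    obtain ⟨h, w, j, hh, hj, hall⟩ := ih (X ∪ G j₀) (E.erase h₀)
      (fun x hx => hX x fun h => hx (mem_union_left _ h)) (by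
        rw [card_erase_of_mem hh₀]
        have : 2 ^ ((X ∪ G j₀).card + m * d) ≤ 2 ^ (X.card + (m + 1) * d) :=
          Nat.pow_le_pow_right (by norm_num) hcard
        omega)
    refine ⟨Fin.cons h₀ h, Fin.cons x w, Fin.cons j₀ j,
      Fin.cons_injective_iff.2 ⟨?_, hh⟩, Fin.cons_injective_iff.2 ⟨?_, hj⟩, ?_⟩
    · rintro ⟨i, rfl⟩
      exact notMem_erase _ _ (hall i).1
    · rintro ⟨i, rfl⟩
      exact (hall i).2.2.2 (mem_union_right _ (hall i).2.2.1)
    · refine Fin.cases ⟨hh₀, hx, hj₀, hxX⟩ fun i => ?_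
      obtain ⟨h1, h2, h3, h4⟩ := hall i
      exact ⟨mem_of_mem_erase h1, h2, h3, fun h => h4 (mem_union_left _ h)⟩

/-! ### The skeleton hypergraph -/

/-- The vertices of the skeleton: core vertices `σ`, then `k - 2` padding vertices for each pair of
core vertices, then `q` blocks of `k - 1` vertices each. -/
abbrev SkeletonVertex (σ : Type*) (k q : ℕ) : Type _ :=
  σ ⊕ (Sym2 σ × Fin (k - 2)) ⊕ (Fin q × Fin (k - 1))

section Skeleton

variable {σ α : Type*} [DecidableEq α] {k q : ℕ}
  (ι : SkeletonVertex σ k q ↪ α)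

/-- The image in `α` of the block with index `j`. -/
def block (j : Fin q) : Finset α :=
  univ.image fun i => ι (.inr (.inr (j, i)))

/-- The hyperedge joining a core vertex to all vertices of a block. -/
def blockEdge (p : σ × Fin q) : Finset α :=
  insert (ι (.inl p.1)) (block ι p.2)

theorem mem_block {x : α} {j : Fin q} : x ∈ block ι j ↔ ∃ i, ι (.inr (.inr (j, i))) = x := by
  simp [block]

theorem mem_blockEdge {x : α} {p : σ × Fin q} :
    x ∈ blockEdge ι p ↔ x = ι (.inl p.1) ∨ ∃ i, ι (.inr (.inr (p.2, i))) = x := by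
  simp [blockEdge, mem_block]

theorem card_block (j : Fin q) : (block ι j).card = k - 1 := by
  rw [block, card_image_of_injective _ (fun a b h => by simpa using h), card_univ, Fintype.card_fin]

theorem block_index_unique {x : α} {j j' : Fin q} (h : x ∈ block ι j) (h' : x ∈ block ι j') :
    j = j' := by
  obtain ⟨i, rfl⟩ := (mem_block ι).1 h
  obtain ⟨i', hi'⟩ := (mem_block ι).1 h'
  simp at hi'
  exact hi'.1.symm

theorem core_notMem_block (t : σ) (j : Fin q) : ι (.inl t) ∉ block ι j := by
  simp [mem_block]

theorem blockEdge_injective (hk : 3 ≤ k) : Function.Injective (blockEdge ι) := by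
  rintro ⟨t, j⟩ ⟨t', j'⟩ h
  have h1 : ι (.inl t) ∈ blockEdge ι (t', j') := by
    rw [← h]; simp [mem_blockEdge]
  have h2 : ι (.inr (.inr (j, ⟨0, by omega⟩))) ∈ blockEdge ι (t', j') := by
    rw [← h]; simp [mem_blockEdge]
  simp [mem_blockEdge] at h1 h2
  rw [h1, h2]

variable [DecidableEq σ]

/-- The hyperedge joining the two core vertices of `z`, filled up with its own padding vertices.
It is used only for pairs `z` off the diagonal, where it has `k` vertices. -/
def pairEdge (z : Sym2 σ) : Finset α :=
  (z.toFinset.image fun t => ι (.inl t)) ∪ univ.image fun i => ι (.inr (.inl (z, i)))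

/-- The hypergraph formed by all block edges and all off-diagonal pair edges. -/
def skeleton [Fintype σ] : Finset (Finset α) :=
  (univ.filter fun z : Sym2 σ => ¬ z.IsDiag).image (pairEdge ι) ∪ univ.image (blockEdge ι)

theorem mem_pairEdge {x : α} {z : Sym2 σ} :
    x ∈ pairEdge ι z ↔ (∃ t ∈ z, ι (.inl t) = x) ∨ ∃ i, ι (.inr (.inl (z, i))) = x := by
  simp [pairEdge]

theorem mem_skeleton [Fintype σ] {e : Finset α} :
    e ∈ skeleton ι ↔ (∃ z : Sym2 σ, ¬ z.IsDiag ∧ pairEdge ι z = e) ∨ ∃ p, blockEdge ι p = e := by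
  simp only [skeleton, mem_union, mem_image, mem_filter, mem_univ, true_and]

theorem card_of_mem_skeleton [Fintype σ] (hk : 3 ≤ k) {e : Finset α} (he : e ∈ skeleton ι) :
    e.card = k := by
  rcases (mem_skeleton ι).1 he with ⟨z, hz, rfl⟩ | ⟨p, rfl⟩
  · rw [pairEdge, card_union_of_disjoint, card_image_of_injective _ (fun a b h => by simpa using h),
      card_image_of_injective _ (fun a b h => by simpa using h), card_univ, Fintype.card_fin,
      Sym2.card_toFinset_of_not_isDiag z hz]
    · omega
    · simp [disjoint_left]
  · rw [blockEdge, card_insert_of_notMem (core_notMem_block ι _ _), card_block]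
    omega

/-- A skeleton edge meets at most one block. -/
theorem block_unique_of_mem_skeleton [Fintype σ] {e : Finset α} (he : e ∈ skeleton ι) {x y : α}
    {j j' : Fin q} (hx : x ∈ e) (hy : y ∈ e) (hxj : x ∈ block ι j) (hyj : y ∈ block ι j') :
    j = j' := by
  obtain ⟨i, rfl⟩ := (mem_block ι).1 hxj
  obtain ⟨i', rfl⟩ := (mem_block ι).1 hyj
  rcases (mem_skeleton ι).1 he with ⟨z, hz, rfl⟩ | ⟨p, rfl⟩
  · simp [mem_pairEdge] at hx
  · simp [mem_blockEdge] at hx hy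
    rw [← hx, ← hy]

theorem pairEdge_injective (hk : 3 ≤ k) : Function.Injective (pairEdge ι) := by
  intro z z' h
  have : ι (.inr (.inl (z, ⟨0, by omega⟩))) ∈ pairEdge ι z' := by
    rw [← h]; simp [mem_pairEdge]
  simp [mem_pairEdge] at this
  exact this.symm

theorem pairEdge_ne_blockEdge (hk : 3 ≤ k) (z : Sym2 σ) (p : σ × Fin q) :
    pairEdge ι z ≠ blockEdge ι p := by
  intro h
  have : ι (.inr (.inl (z, ⟨0, by omega⟩))) ∈ blockEdge ι p := by
    rw [← h]; simp [mem_pairEdge]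
  simp [mem_blockEdge] at this

/-- The non-core vertices of a skeleton edge lie only in few skeleton edges: those of one block, or
a single pair edge. -/
theorem skeleton_locally_sparse [Fintype σ] {e : Finset α} (he : e ∈ skeleton ι) :
    ∃ A : Finset (Finset α), A.card ≤ Fintype.card σ ∧
      ∀ x ∈ e, x ∉ univ.image (fun t => ι (.inl t)) → ∀ g ∈ skeleton ι, x ∈ g → g ∈ A := by
  rcases (mem_skeleton ι).1 he with ⟨z, hz, rfl⟩ | ⟨⟨t, j⟩, rfl⟩
  · refine ⟨{pairEdge ι z}, ?_, ?_⟩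
    · rw [card_singleton]
      exact Fintype.card_pos_iff.2 ⟨z.out.1⟩
    · intro x hx hxS g hg hxg
      simp only [mem_image, mem_univ, true_and, not_exists] at hxS
      rcases (mem_pairEdge ι).1 hx with ⟨t, -, rfl⟩ | ⟨i, rfl⟩
      · exact absurd rfl (hxS t)
      rcases (mem_skeleton ι).1 hg with ⟨z', hz', rfl⟩ | ⟨p, rfl⟩
      · simp [mem_pairEdge] at hxg
        simp [hxg]
      · simp [mem_blockEdge] at hxg
  · refine ⟨univ.image fun t => blockEdge ι (t, j), card_image_le, ?_⟩
    intro x hx hxS g hg hxg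
    simp only [mem_image, mem_univ, true_and, not_exists] at hxS
    rcases (mem_blockEdge ι).1 hx with rfl | ⟨i, rfl⟩
    · exact absurd rfl (hxS t)
    rcases (mem_skeleton ι).1 hg with ⟨z', hz', rfl⟩ | ⟨⟨t', j'⟩, rfl⟩
    · simp [mem_pairEdge] at hxg
    · simp [mem_blockEdge] at hxg
      simp [hxg]

/-! ### Bounded degrees in Berge-free extensions -/

/-- A star whose vertices lie in distinct blocks, together with the skeleton, carries every graph
`F` in which deleting `T` leaves only edges at the vertex `t₀`. -/
theorem containsBerge_of_star {V : Type*} [DecidableEq V] {F : SimpleGraph V} (hk : 3 ≤ k)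
    (T : Finset V) (t₀ : V) (ht₀ : t₀ ∉ T)
    (hstar : ∀ u v, F.Adj u v → u ∉ T → v ∉ T → u = t₀ ∨ v = t₀)
    (ι : SkeletonVertex T k q ↪ α) {H : Finset (Finset α)} (hH : skeleton ι ⊆ H)
    (w : V → α) (j : V → Fin q) (h : V → Finset α)
    (hj : Set.InjOn j {u | u ∉ T}) (hh : Set.InjOn h {u | u ∉ T ∧ u ≠ t₀})
    (hwj : ∀ u ∉ T, w u ∈ block ι (j u))
    (hhw : ∀ u ∉ T, u ≠ t₀ → h u ∈ H ∧ w u ∈ h u ∧ w t₀ ∈ h u) : ContainsBerge F H := by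
  have hskel : ∀ u ∉ T, u ≠ t₀ → h u ∉ skeleton ι := fun u hu hut hs =>
    hut (hj hu ht₀ (block_unique_of_mem_skeleton ι hs (hhw u hu hut).2.1 (hhw u hu hut).2.2
      (hwj u hu) (hwj t₀ ht₀)))
  -- `T` is mapped to the core, all other vertices into the blocks by `w`.
  let f : V → α := fun u => if hu : u ∈ T then ι (.inl ⟨u, hu⟩) else w u
  have hfT : ∀ u (hu : u ∈ T), f u = ι (.inl ⟨u, hu⟩) := fun u hu => dif_pos hu
  have hfw : ∀ u ∉ T, f u = w u := fun u hu => dif_neg hu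
  have hf : Function.Injective f := by
    intro a b hab
    by_cases ha : a ∈ T <;> by_cases hb : b ∈ T
    · rw [hfT a ha, hfT b hb] at hab
      simpa using hab
    · rw [hfT a ha, hfw b hb] at hab
      exact absurd (hab ▸ hwj b hb) (core_notMem_block ι _ _)
    · rw [hfw a ha, hfT b hb] at hab
      exact absurd (hab ▸ hwj a ha) (core_notMem_block ι _ _)
    · rw [hfw a ha, hfw b hb] at hab
      exact hj ha hb (block_index_unique ι (hwj a ha) (hab ▸ hwj b hb))
  -- The hyperedge assigned to an edge, as a relation which is injective in the edge.
  let P : Sym2 V → Finset α → Prop := fun e C =>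
    (∃ (u v : T), u ≠ v ∧ e = s(u.1, v.1) ∧ C = pairEdge ι s(u, v)) ∨
    (∃ (u : T) (v : V), v ∉ T ∧ e = s(u.1, v) ∧ C = blockEdge ι (u, j v)) ∨
    (∃ v, v ∉ T ∧ v ≠ t₀ ∧ e = s(t₀, v) ∧ C = h v)
  have hpairmem : ∀ u v : T, u ≠ v → pairEdge ι s(u, v) ∈ skeleton ι := fun u v huv =>
    (mem_skeleton ι).2 (.inl ⟨_, by simpa using huv, rfl⟩)
  have hblockmem : ∀ p, blockEdge ι p ∈ skeleton ι := fun p =>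
    (mem_skeleton ι).2 (.inr ⟨p, rfl⟩)
  have hex : ∀ e : F.edgeSet, ∃ C, P e C := by
    rintro ⟨e, he⟩
    induction e using Sym2.ind with | _ u v => ?_
    have huv : F.Adj u v := he
    by_cases hu : u ∈ T <;> by_cases hv : v ∈ T
    · exact ⟨_, .inl ⟨⟨u, hu⟩, ⟨v, hv⟩, fun hc => huv.ne (congrArg Subtype.val hc), rfl, rfl⟩⟩
    · exact ⟨_, .inr (.inl ⟨⟨u, hu⟩, v, hv, rfl, rfl⟩)⟩
    · exact ⟨_, .inr (.inl ⟨⟨v, hv⟩, u, hu, Sym2.eq_swap, rfl⟩)⟩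
    · rcases hstar u v huv hu hv with rfl | rfl
      · exact ⟨_, .inr (.inr ⟨v, hv, huv.ne', rfl, rfl⟩)⟩
      · exact ⟨_, .inr (.inr ⟨u, hu, huv.ne, Sym2.eq_swap, rfl⟩)⟩
  have hinj : ∀ e e' C, P e C → P e' C → e = e' := by
    rintro e e' C (⟨u, v, huv, rfl, rfl⟩ | ⟨u, v, hv, rfl, rfl⟩ | ⟨v, hv, hvt, rfl, rfl⟩)
      (⟨u', v', huv', rfl, hC⟩ | ⟨u', v', hv', rfl, hC⟩ | ⟨v', hv', hvt', rfl, hC⟩)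
    · have := pairEdge_injective ι hk hC
      simpa using congrArg (Sym2.map Subtype.val) this
    · exact absurd hC (pairEdge_ne_blockEdge ι hk _ _)
    · exact absurd (hC ▸ hpairmem u v huv) (hskel v' hv' hvt')
    · exact absurd hC.symm (pairEdge_ne_blockEdge ι hk _ _)
    · have := blockEdge_injective ι hk hC
      rw [Prod.mk.injEq] at this
      rw [this.1, hj hv hv' this.2]
    · exact absurd (hC ▸ hblockmem (u, j v)) (hskel v' hv' hvt')
    · exact absurd (hC ▸ hpairmem u' v' huv') (hskel v hv hvt)
    · exact absurd (hC ▸ hblockmem (u', j v')) (hskel v hv hvt)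
    · rw [hh ⟨hv, hvt⟩ ⟨hv', hvt'⟩ hC]
  choose ψ hψ using hex
  refine containsBerge_of_injective f hf ψ
    (fun a b hab => Subtype.ext (hinj _ _ _ (hψ a) (hab ▸ hψ b))) ?_ ?_
  · intro e
    rcases hψ e with ⟨u, v, huv, -, hC⟩ | ⟨u, v, hv, -, hC⟩ | ⟨v, hv, hvt, -, hC⟩
    · exact hC ▸ hH (hpairmem u v huv)
    · exact hC ▸ hH (hblockmem _)
    · exact hC ▸ (hhw v hv hvt).1
  · intro e x hx
    rcases hψ e with ⟨u, v, huv, he, hC⟩ | ⟨u, v, hv, he, hC⟩ | ⟨v, hv, hvt, he, hC⟩ <;>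
      rw [he, Sym2.mem_iff] at hx <;> rw [hC]
    · rcases hx with rfl | rfl <;> rw [hfT _ (Subtype.prop _)] <;> simp [mem_pairEdge]
    · rcases hx with rfl | rfl
      · rw [hfT _ u.2]; simp [mem_blockEdge]
      · rw [hfw _ hv]
        exact mem_insert_of_mem (hwj _ hv)
    · rcases hx with rfl | rfl
      · rw [hfw _ ht₀]; exact (hhw v hv hvt).2.2
      · rw [hfw _ hv]; exact (hhw _ hv hvt).2.1

/-- In a Berge-`F`-free hypergraph containing the skeleton, block vertices have bounded degree:
otherwise `exists_transversal` yields a star as in `containsBerge_of_star`. -/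
theorem degree_le_of_not_containsBerge {V : Type*} [DecidableEq V] {F : SimpleGraph V}
    (hk : 3 ≤ k) (T I : Finset V) (t₀ : V) (ht₀ : t₀ ∉ T) (ht₀I : t₀ ∉ I)
    (hcover : ∀ u, u ∉ T → u ≠ t₀ → u ∈ I) (hI : F.IsIndepSet I)
    (ι : SkeletonVertex T k q ↪ α) {H : Finset (Finset α)} (hH : skeleton ι ⊆ H)
    (hfree : ¬ ContainsBerge F H) (X : Finset α) (hX : ∀ x ∉ X, ∃ j, x ∈ block ι j)
    {v : α} (hv : v ∉ X) :
    (H.filter fun e => v ∈ e).card ≤ I.card + 2 ^ (X.card + (k - 1) + I.card * (k - 1)) := by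
  by_contra! hlt
  apply hfree
  obtain ⟨j₀, hj₀⟩ := hX v hv
  have hcard : (X ∪ block ι j₀).card ≤ X.card + (k - 1) :=
    (card_union_le _ _).trans (by rw [card_block])
  obtain ⟨h, w, j, hh, hj, hall⟩ := exists_transversal (block ι) (fun j => (card_block ι j).le)
    I.card (X ∪ block ι j₀) (H.filter fun e => v ∈ e)
    (fun x hx => hX x fun h => hx (mem_union_left _ h))
    (lt_of_le_of_lt (Nat.add_le_add_left (Nat.pow_le_pow_right (by norm_num) (by omega)) _) hlt)
  let φ := I.equivFin
  have hjne : ∀ i, j i ≠ j₀ := fun i hi =>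
    (hall i).2.2.2 (mem_union_right _ (hi ▸ (hall i).2.2.1))
  refine containsBerge_of_star hk T t₀ ht₀ ?_ ι hH
    (fun u => if hu : u ∈ I then w (φ ⟨u, hu⟩) else v)
    (fun u => if hu : u ∈ I then j (φ ⟨u, hu⟩) else j₀)
    (fun u => if hu : u ∈ I then h (φ ⟨u, hu⟩) else ∅) ?_ ?_ ?_ ?_
  · intro a b hab ha hb
    by_contra! hne
    exact hI (hcover a ha hne.1) (hcover b hb hne.2) hab.ne hab
  · intro a ha b hb hab
    by_cases haI : a ∈ I <;> by_cases hbI : b ∈ I <;> simp only [haI, hbI, dif_pos, dif_neg,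
      not_false_eq_true] at hab
    · simpa using φ.injective (hj hab)
    · exact absurd hab (hjne _)
    · exact absurd hab.symm (hjne _)
    · rw [not_imp_comm.1 (hcover a ha) haI, not_imp_comm.1 (hcover b hb) hbI]
  · rintro a ⟨ha, hat⟩ b ⟨hb, hbt⟩ hab
    simp only [hcover a ha hat, hcover b hb hbt, dif_pos] at hab
    simpa using φ.injective (hh hab)
  · intro u hu
    by_cases huI : u ∈ I
    · simpa only [huI, dif_pos] using (hall _).2.2.1
    · simpa only [huI, dif_neg, not_false_eq_true] using hj₀
  · intro u hu hut
    have := hall (φ ⟨u, hcover u hu hut⟩)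
    simp only [hcover u hu hut, ht₀I, dif_pos, dif_neg, not_false_eq_true]
    exact ⟨(mem_filter.1 this.1).1, this.2.1, (mem_filter.1 this.1).2⟩

end Skeleton

/-! ### The linear upper bound -/

theorem card_le_of_degree_le {α : Type*} [Fintype α] [DecidableEq α] {H : Finset (Finset α)}
    {X : Finset α} {D : ℕ} (hD : ∀ v ∉ X, (H.filter fun e => v ∈ e).card ≤ D) :
    H.card ≤ 2 ^ X.card + Fintype.card α * D := by
  have hsub : H ⊆ X.powerset ∪ Xᶜ.biUnion fun v => H.filter fun e => v ∈ e := by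
    intro e he
    by_cases heX : e ⊆ X
    · exact mem_union_left _ (mem_powerset.2 heX)
    · obtain ⟨v, hve, hvX⟩ := not_subset.1 heX
      exact mem_union_right _
        (mem_biUnion.2 ⟨v, mem_compl.2 hvX, mem_filter.2 ⟨he, hve⟩⟩)
  refine (card_le_card hsub).trans ((card_union_le _ _).trans ?_)
  rw [card_powerset]
  refine Nat.add_le_add_left ((card_biUnion_le_card_mul _ _ D fun v hv => hD v (mem_compl.1 hv)).trans
    (Nat.mul_le_mul_right _ (card_le_univ _))) _

/-- The skeleton on `n` vertices, completed to a saturated hypergraph, has linearly many edges. -/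
theorem exists_isBergeSaturated_card_le {V : Type*} [Fintype V] [DecidableEq V] {F : SimpleGraph V}
    [DecidableRel F.Adj] {k : ℕ} (hk : 3 ≤ k) (T I : Finset V) (t₀ : V) (ht₀ : t₀ ∉ T)
    (ht₀I : t₀ ∉ I) (hcover : ∀ u, u ∉ T → u ≠ t₀ → u ∈ I) (hI : F.IsIndepSet I)
    (hδ : T.card + 1 < 2 * F.minDegree) (hα : F.indepNum + T.card < Fintype.card V) :
    ∃ c D : ℕ, ∀ n ≥ c, ∃ H : Finset (Finset (Fin n)),
      IsBergeSaturated k F H ∧ H.card ≤ D + n * D := by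
  set c := Fintype.card (T ⊕ (Sym2 T × Fin (k - 2))) with hc
  set b := c + (k - 1)
  refine ⟨c, I.card + 2 ^ (b + (k - 1) + I.card * (k - 1)), fun n hn => ?_⟩
  -- As many disjoint blocks as fit next to the core and the padding; fewer than `k - 1` vertices are
  -- left over, and these lie in no skeleton edge.
  set q := (n - c) / (k - 1) with hq
  have hdiv := Nat.div_add_mod (n - c) (k - 1)
  have hmod := Nat.mod_lt (n - c) (show 0 < k - 1 by omega)
  rw [← hq, mul_comm] at hdiv
  have hle : Fintype.card (SkeletonVertex T k q) ≤ Fintype.card (Fin n) := by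
    simp only [SkeletonVertex, Fintype.card_sum, Fintype.card_prod, Fintype.card_fin] at hc ⊢
    omega
  obtain ⟨ι⟩ := Function.Embedding.nonempty_of_card_le hle
  obtain ⟨H, hsub, hH⟩ := exists_isBergeSaturated_superset (F := F) (H₀ := skeleton ι) (k := k)
    (fun e he => card_of_mem_skeleton ι hk he)
    (not_containsBerge_of_locally_sparse (S := univ.image fun t => ι (.inl t)) (c := T.card)
      (card_image_le.trans (by simp)) hδ hα
      fun e he => by simpa using skeleton_locally_sparse ι he)
  refine ⟨H, hH, ?_⟩
  let U : Finset (Fin n) := univ.image fun p : Fin q × Fin (k - 1) => ι (.inr (.inr p))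
  have hU : U.card = q * (k - 1) := by
    rw [card_image_of_injective _ (fun a b h => by simpa using h)]
    simp
  have hX : ∀ x ∉ Uᶜ, ∃ j, x ∈ block ι j := by
    intro x hx
    simp only [mem_compl, not_not, U, mem_image, mem_univ, true_and] at hx
    obtain ⟨⟨j, i⟩, rfl⟩ := hx
    exact ⟨j, (mem_block ι).2 ⟨i, rfl⟩⟩
  have hXcard : Uᶜ.card ≤ b := by
    rw [card_compl, hU, Fintype.card_fin]
    omega
  have hpow : ∀ r, 2 ^ (Uᶜ.card + r) ≤ 2 ^ (b + r) := fun r =>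
    Nat.pow_le_pow_right (by norm_num) (by omega)
  have hdeg := card_le_of_degree_le (H := H) (X := Uᶜ)
    (D := I.card + 2 ^ (b + (k - 1) + I.card * (k - 1))) fun v hv =>
      (degree_le_of_not_containsBerge hk T I t₀ ht₀ ht₀I hcover hI ι hsub hH.2.1 Uᶜ hX hv).trans
        (by have := hpow ((k - 1) + I.card * (k - 1)); simp only [← add_assoc] at this; omega)
  rw [Fintype.card_fin] at hdeg
  refine hdeg.trans (Nat.add_le_add_right ?_ _)
  exact (Nat.pow_le_pow_right (by norm_num) (by omega)).trans (Nat.le_add_left _ _)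

theorem theorem1p4 {V : Type*} [Fintype V] (F : SimpleGraph V) [DecidableRel F.Adj] (k : ℕ)
    (hk : 3 ≤ k)
    (hF : ((Fintype.card V : ℝ) - (F.indepNum : ℝ)) / 2 < (F.minDegree : ℝ)) :
    (∀ n : ℕ, ∃ H : Finset (Finset (Fin n)),
      IsBergeSaturated k F H ∧ H.card = bergeSat k n F) ∧
    (fun n : ℕ => (bergeSat k n F : ℝ)) =O[atTop] (fun n : ℕ => (n : ℝ)) := by
  classical
  have hF' : Fintype.card V < 2 * F.minDegree + F.indepNum := by
    have : (Fintype.card V : ℝ) < 2 * F.minDegree + F.indepNum := by linarith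
    exact_mod_cast this
  obtain ⟨I, hI⟩ := F.exists_isNIndepSet_indepNum
  have hIle : F.indepNum ≤ Fintype.card V := hI.card_eq ▸ card_le_univ I
  have hδ : 0 < F.minDegree := by omega
  have hne : Nonempty V := by
    by_contra hV
    rw [not_nonempty_iff] at hV
    simp [SimpleGraph.minDegree] at hδ
  obtain ⟨u⟩ := hne
  obtain ⟨v, huv⟩ := (F.degree_pos_iff_exists_adj u).1 (hδ.trans_le (F.minDegree_le_degree u))
  obtain ⟨t₀, ht₀⟩ : ∃ t, t ∉ I := by
    by_contra! hall
    exact hI.isIndepSet (hall u) (hall v) huv.ne huv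
  constructor
  · intro n
    obtain ⟨H, -, hH⟩ := exists_isBergeSaturated_superset (α := Fin n) (F := F) (k := k)
      (H₀ := ∅) (by simp) (not_containsBerge_empty huv)
    exact Nat.sInf_mem (s := {m | ∃ H : Finset (Finset (Fin n)),
      IsBergeSaturated k F H ∧ H.card = m}) ⟨H.card, H, hH, rfl⟩
  · have hTcard : (Iᶜ.erase t₀).card + 1 + F.indepNum = Fintype.card V := by
      rw [card_erase_add_one (mem_compl.2 ht₀), ← hI.card_eq, card_compl_add_card]
    obtain ⟨c, D, hD⟩ := exists_isBergeSaturated_card_le (F := F) hk (Iᶜ.erase t₀) I t₀ (by simp) ht₀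
      (fun u hu hut => by simpa [hut] using hu) hI.isIndepSet (by omega) (by omega)
    refine IsBigO.of_bound (2 * D : ℝ) ?_
    filter_upwards [eventually_ge_atTop c, eventually_ge_atTop 1] with n hn hn1
    obtain ⟨H, hH, hcard⟩ := hD n hn
    have h1 : bergeSat k n F ≤ D + n * D :=
      le_trans (Nat.sInf_le (m := H.card) (show _ ∈ {m | _} from ⟨H, hH, rfl⟩)) hcard
    have h2 : D + n * D ≤ 2 * D * n := by nlinarith
    rw [Real.norm_natCast, Real.norm_natCast]
    exact_mod_cast h1.trans h2
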